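/- A closed plane curve is a $1$-periodic immersion $\gamma\in C^2(\mathbb R;\mathbb R^2)$ (parameter $u$). Let $s$ be its arc length, $L$ its length, $\tau=\partial_s\gamma$, $\nu$ the rotation of $\tau$ by $+\pi/2$, $\kappa=\partial_s^2\gamma\cdot\nu$, $\tilde\kappa=\kappa-\frac1L\int_0^L\kappa\,ds$, $A=-\frac12\int_0^L\gamma\cdot\nu\,ds$, and $n=\frac1{2\pi}\int_0^L\kappa\,ds$ its rotation number. Consider the flow $$\partial_t\mathbf f=\Big(\tilde\kappa-\frac gL\Big)\nu ,$$ where - (AP) $g=0$; - (LP) $g=L\big(\int_0^L\kappa\,ds\big)^{-1}\int_0^L\tilde\kappa^2\,ds$; - (JP) $g=\frac{L^2}{2A}-\int_0^L\kappa\,ds$. A classical solution on $[0,T)$ is a family of closed plane curves $\mathbf f(\cdot,t)$, $0\le t<T$, such that $\mathbf f$ is $C^\infty$ in $(u,t)$ for $0<t<T$; $\mathbf f,\partial_u\mathbf f,\partial_u^2\mathbf f$ are continuous for $0\le t<T$; the denominator in $g$ does not vanish for $0\le t<T$ (that is, $\int_0^L\kappa\,ds\ne0$ for (LP), $A\neq0$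 for (JP)); and the equation holds, with $\partial_t$ taken at fixed $u$, for $0<t<T$. The time $T$ is the blow-up time if, for every $T'>T$, the solution does not extend to a classical solution on $[0,T')$. **Theorem.** Let $T\in(0,\infty)$ be the blow-up time of a classical solution $\mathbf f$ of one of (AP), (LP), (JP), whose initial curve has rotation number $n\ge1$ and, in the case (JP), satisfies $A(0)>0$. Assume that $$\limsup_{t\to T-0}\ \max_s\kappa(s,t)=\infty .$$ Then, for all $t\in[0,T)$, $$\max_s\kappa(s,t)\ \ge\ \frac1{\sqrt{2(T-t)}} .$$ -/

import Mathlib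

open Set Filter Topology
open scoped ContDiff

noncomputable section

namespace CurveFlow

/-! Closed plane curves are maps `γ : ℝ → ℂ` of period `1` with `γ' ≠ 0`; the plane `ℝ²` is `ℂ`
with its real inner product.  All quantities are invariant under reparametrization; `∂ₛ` is
`‖γ'‖⁻¹ ∂ᵤ` and `ds` is `‖γ'‖ du`. -/

/-- The derivative of `h` along `γ` with respect to the arc length of `γ`. -/
def arcDeriv (γ h : ℝ → ℂ) (u : ℝ) : ℂ := ‖deriv γ u‖⁻¹ • deriv h u

/-- The integral `∫₀ᴸ h ds` over one period. -/
def arcIntegral (γ : ℝ → ℂ) (h : ℝ → ℝ) : ℝ := ∫ u in (0 : ℝ)..1, h u * ‖deriv γ u‖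

/-- The total length `L`. -/
def length (γ : ℝ → ℂ) : ℝ := arcIntegral γ fun _ => 1

/-- The unit tangent `τ = ∂ₛ γ`. -/
def tangent (γ : ℝ → ℂ) : ℝ → ℂ := arcDeriv γ γ

/-- The unit normal `ν`: the tangent turned counter-clockwise by `π / 2`. -/
def normal (γ : ℝ → ℂ) (u : ℝ) : ℂ := Complex.I * tangent γ u

/-- The curvature vector `∂ₛ² γ`. -/
def curvatureVec (γ : ℝ → ℂ) : ℝ → ℂ := arcDeriv γ (tangent γ)

/-- The signed curvature `κ`. -/
def curvature (γ : ℝ → ℂ) (u : ℝ) : ℝ := inner ℝ (curvatureVec γ u) (normal γ u)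

/-- The total curvature `∫₀ᴸ κ ds`. -/
def totalCurvature (γ : ℝ → ℂ) : ℝ := arcIntegral γ (curvature γ)

/-- The rotation number `(2π)⁻¹ ∫₀ᴸ κ ds`. -/
def rotationNumber (γ : ℝ → ℂ) : ℝ := 1 / (2 * Real.pi) * totalCurvature γ

/-- The deviation of the curvature from its mean. -/
def curvatureDeviation (γ : ℝ → ℂ) (u : ℝ) : ℝ :=
  curvature γ u - 1 / length γ * totalCurvature γ

/-- The signed area `A = -½ ∫₀ᴸ γ · ν ds`. -/
def signedArea (γ : ℝ → ℂ) : ℝ := -(1 / 2) * arcIntegral γ fun u => inner ℝ (γ u) (normal γ u)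

/-- The maximum of the curvature along the curve. -/
def maxCurvature (γ : ℝ → ℂ) : ℝ := sSup (range (curvature γ))

/-- The three flows: area-preserving, length-preserving, Jiang–Pan. -/
inductive Flow
  | AP
  | LP
  | JP

/-- The non-local quantity `g` of each flow. -/
def Flow.g : Flow → (ℝ → ℂ) → ℝ
  | .AP, _ => 0
  | .LP, γ => length γ * (totalCurvature γ)⁻¹ * arcIntegral γ fun u => curvatureDeviation γ u ^ 2
  | .JP, γ => length γ ^ 2 / (2 * signedArea γ) - totalCurvature γ

/-- The denominator that occurs in `g` does not vanish. -/
def Flow.Admissible : Flow → (ℝ → ℂ) → Prop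
  | .AP, _ => True
  | .LP, γ => totalCurvature γ ≠ 0
  | .JP, γ => signedArea γ ≠ 0

/-- `F t u` is a classical solution of `∂ₜ F = (κ̃ - g / L) ν` on `[0, T)`: a family of closed
immersed curves, smooth for `0 < t < T`, and twice continuously differentiable in space up to the
initial time `t = 0`. -/
structure IsClassicalSolution (flow : Flow) (F : ℝ → ℝ → ℂ) (T : ℝ) : Prop where
  periodic : ∀ t ∈ Ico 0 T, Function.Periodic (F t) 1
  immersed : ∀ t ∈ Ico 0 T, ∀ u, deriv (F t) u ≠ 0
  smooth : ContDiffOn ℝ ∞ (fun p : ℝ × ℝ => F p.1 p.2) (Ioo 0 T ×ˢ univ)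
  contDiff : ∀ t ∈ Ico 0 T, ContDiff ℝ 2 (F t)
  continuousOn : ContinuousOn (fun p : ℝ × ℝ => F p.1 p.2) (Ico 0 T ×ˢ univ)
  continuousOn_deriv : ContinuousOn (fun p : ℝ × ℝ => deriv (F p.1) p.2) (Ico 0 T ×ˢ univ)
  continuousOn_deriv_two :
    ContinuousOn (fun p : ℝ × ℝ => deriv (deriv (F p.1)) p.2) (Ico 0 T ×ˢ univ)
  admissible : ∀ t ∈ Ico 0 T, flow.Admissible (F t)
  equation : ∀ t ∈ Ioo 0 T, ∀ u, HasDerivAt (fun t' => F t' u)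
    ((curvatureDeviation (F t) u - flow.g (F t) / length (F t)) • normal (F t) u) t

/-- `T` is the (finite) blow-up time of the solution `F`: its maximal time of existence. -/
def IsBlowUpTime (flow : Flow) (F : ℝ → ℝ → ℂ) (T : ℝ) : Prop :=
  IsClassicalSolution flow F T ∧
    ∀ T' > T, ¬ ∃ G : ℝ → ℝ → ℂ, IsClassicalSolution flow G T' ∧ ∀ t ∈ Ico 0 T, G t = F t

end CurveFlow

end

noncomputable section

namespace CurveFlow

/-! ### Calculus -/

/-! The proof is a maximum principle for the curvature. Write `V` for the normal speed. Where `κ` is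
stationary along the curve, `∂ₜκ = ∂ₛ²κ + V κ²` (`hasDerivAt_curvature`). Moreover `κ - V = (∫κ ds +
g) / L`, which is nonnegative for all three flows once `∫κ ds > 0` and, for (JP), `A > 0`; both
signs persist in time (`totalCurvature_eq`, `signedArea_pos`). Hence `∂ₜκ ≤ κ³` at a spatial
maximum.

The solutions of `c' = c³` that blow up at `T` are exactly `1 / √(2 (T - t))`. If the maximal
curvature were below this value at some time, a slightly faster growing barrier that is still finite
at `T` would bound `κ` from above up to `T` (`curvature_lt`), contrary to the assumption on the
limsup. The strictly faster growth excludes a first contact (`lt_of_no_touching`). -/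

theorem hasDerivAt_slice_snd {G : ℝ × ℝ → ℂ} {t u : ℝ} (hG : DifferentiableAt ℝ G (t, u)) :
    HasDerivAt (fun x => G (t, x)) (fderiv ℝ G (t, u) (0, 1)) u := by
  have h : HasDerivAt (fun x : ℝ => (t, x)) ((0 : ℝ), (1 : ℝ)) u :=
    (hasDerivAt_const u t).prodMk (hasDerivAt_id u)
  exact HasFDerivAt.comp_hasDerivAt (f := fun x : ℝ => (t, x)) u hG.hasFDerivAt h

theorem hasDerivAt_slice_fst {G : ℝ × ℝ → ℂ} {t u : ℝ} (hG : DifferentiableAt ℝ G (t, u)) :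
    HasDerivAt (fun s => G (s, u)) (fderiv ℝ G (t, u) (1, 0)) t := by
  have h : HasDerivAt (fun s : ℝ => (s, u)) ((1 : ℝ), (0 : ℝ)) t :=
    (hasDerivAt_id t).prodMk (hasDerivAt_const t u)
  exact HasFDerivAt.comp_hasDerivAt (f := fun s : ℝ => (s, u)) t hG.hasFDerivAt h

theorem contDiffOn_deriv_slice {G : ℝ × ℝ → ℂ} {U : Set (ℝ × ℝ)} (hU : IsOpen U)
    (hG : ContDiffOn ℝ ∞ G U) :
    ContDiffOn ℝ ∞ (fun p : ℝ × ℝ => deriv (fun x => G (p.1, x)) p.2) U := by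
  have h : ContDiffOn ℝ ∞ (fun p => fderiv ℝ G p (0, 1)) U :=
    (hG.fderiv_of_isOpen hU (by simp)).clm_apply contDiffOn_const
  refine h.congr fun p hp => ?_
  exact (hasDerivAt_slice_snd ((hG.contDiffAt (hU.mem_nhds hp)).differentiableAt (by simp))).deriv

/-- Partial derivatives commute. -/
theorem hasDerivAt_deriv_slice {G : ℝ × ℝ → ℂ} {U : Set (ℝ × ℝ)} (hU : IsOpen U)
    (hG : ContDiffOn ℝ ∞ G U) {t u : ℝ} (hp : (t, u) ∈ U) :
    HasDerivAt (fun s => deriv (fun x => G (s, x)) u)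
      (deriv (fun x => deriv (fun s => G (s, x)) t) u) t := by
  have hd : ∀ p ∈ U, DifferentiableAt ℝ G p := fun p hp =>
    (hG.contDiffAt (hU.mem_nhds hp)).differentiableAt (by simp)
  have hG1 : DifferentiableAt ℝ (fderiv ℝ G) (t, u) :=
    ((hG.fderiv_of_isOpen (m := ∞) hU (by simp)).contDiffAt (hU.mem_nhds hp)).differentiableAt
      (by simp)
  have hsymm : IsSymmSndFDerivAt ℝ G (t, u) :=
    (hG.contDiffAt (hU.mem_nhds hp)).isSymmSndFDerivAt (by
      simpa using WithTop.coe_le_coe.2 (le_top : (2 : ℕ∞) ≤ ⊤))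
  have hv : ∀ v : ℝ × ℝ, HasFDerivAt (fun p => fderiv ℝ G p v)
      ((fderiv ℝ (fderiv ℝ G) (t, u)).flip v) (t, u) := fun v => by
    simpa using hG1.hasFDerivAt.clm_apply (hasFDerivAt_const v (t, u))
  have e1 : (fun x => deriv (fun s => G (s, x)) t) =ᶠ[𝓝 u] fun x => fderiv ℝ G (t, x) (1, 0) := by
    have : ∀ᶠ x in 𝓝 u, (t, x) ∈ U :=
      (by fun_prop : ContinuousAt (fun x : ℝ => (t, x)) u).eventually (hU.mem_nhds hp)
    filter_upwards [this] with x hx using (hasDerivAt_slice_fst (hd _ hx)).deriv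
  have e2 : (fun s => deriv (fun x => G (s, x)) u) =ᶠ[𝓝 t] fun s => fderiv ℝ G (s, u) (0, 1) := by
    have : ∀ᶠ s in 𝓝 t, (s, u) ∈ U :=
      (by fun_prop : ContinuousAt (fun s : ℝ => (s, u)) t).eventually (hU.mem_nhds hp)
    filter_upwards [this] with s hs using (hasDerivAt_slice_snd (hd _ hs)).deriv
  have h1 := hasDerivAt_slice_fst (hv (0, 1)).differentiableAt
  have h2 := hasDerivAt_slice_snd (hv (1, 0)).differentiableAt
  rw [(hv _).fderiv] at h1 h2
  rw [e1.deriv_eq, h2.deriv]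
  refine HasDerivAt.congr_of_eventuallyEq ?_ e2
  exact h1.congr_deriv (hsymm.eq _ _)

/-- A positive second derivative would make the point a local minimum as well, so `f` would be
locally constant and its second derivative zero. -/
theorem deriv_deriv_nonpos_of_isLocalMax {f : ℝ → ℝ} {x : ℝ} (h : IsLocalMax f x)
    (hf : ContinuousAt f x) : deriv (deriv f) x ≤ 0 := by
  by_contra! hpos
  have hmin := isLocalMin_of_deriv_deriv_pos hpos h.deriv_eq_zero hf
  have hc : f =ᶠ[𝓝 x] fun _ => f x := by
    filter_upwards [h, hmin] with y h1 h2 using le_antisymm h1 h2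
  have := hc.deriv.deriv_eq
  simp at this
  linarith

theorem deriv_nonneg_of_le_left {f : ℝ → ℝ} {f' x a : ℝ} (hf : HasDerivAt f f' x) (ha : a < x)
    (h : ∀ y ∈ Ico a x, f y ≤ f x) : 0 ≤ f' := by
  have h1 := (hasDerivAt_iff_tendsto_slope.1 hf).mono_left
    (nhdsWithin_mono x (fun y (hy : y ∈ Iio x) => (ne_of_lt hy : y ≠ x)))
  refine ge_of_tendsto h1 ?_
  filter_upwards [Ico_mem_nhdsLT ha] with y hy
  rw [slope_def_field]
  exact div_nonneg_of_nonpos (by linarith [h y hy]) (by linarith [hy.2])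

/-- The first touching argument of the maximum principle. -/
theorem lt_of_no_touching {K : ℝ → ℝ → ℝ} {c : ℝ → ℝ} {a b : ℝ}
    (hK : ContinuousOn (fun p : ℝ × ℝ => K p.1 p.2) (Ico a b ×ˢ univ))
    (hper : ∀ t ∈ Ico a b, Function.Periodic (K t) 1)
    (hc : ContinuousOn c (Ico a b)) (h0 : ∀ u, K a u < c a)
    (htouch : ∀ t ∈ Ioo a b, ∀ u, K t u = c t → (∀ v, K t v ≤ K t u) →
      (∀ s ∈ Ico a t, K s u < c s) → False) :
    ∀ t ∈ Ico a b, ∀ u, K t u < c t := by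
  by_contra! hcon
  obtain ⟨t₁, ht₁, u₁, hu₁⟩ := hcon
  have hsub : Icc a t₁ ×ˢ Icc (0 : ℝ) 1 ⊆ Ico a b ×ˢ univ := fun p hp =>
    ⟨⟨hp.1.1, hp.1.2.trans_lt ht₁.2⟩, mem_univ _⟩
  have hcK : ContinuousOn (fun p : ℝ × ℝ => c p.1) (Icc a t₁ ×ˢ Icc (0 : ℝ) 1) :=
    hc.comp continuousOn_fst fun p hp => (hsub hp).1
  -- Periodicity allows restriction to one period, which makes the contact set compact; a point of
  -- least time in it is the first contact.
  set S := {p ∈ Icc a t₁ ×ˢ Icc (0 : ℝ) 1 | c p.1 ≤ K p.1 p.2} with hS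
  have hScl : IsCompact S := by
    refine (isCompact_Icc.prod isCompact_Icc).of_isClosed_subset ?_ (sep_subset _ _)
    exact IsClosed.isClosed_le (isClosed_Icc.prod isClosed_Icc) hcK (hK.mono hsub)
  have hfract : ∀ t ∈ Ico a b, ∀ u, K t (Int.fract u) = K t u := fun t ht u => by
    have := (hper t ht).sub_int_mul_eq (x := u) ⌊u⌋
    rwa [mul_one, Int.self_sub_floor] at this
  have hI : ∀ u : ℝ, Int.fract u ∈ Icc (0 : ℝ) 1 := fun u =>
    ⟨Int.fract_nonneg u, (Int.fract_lt_one u).le⟩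
  have hSne : S.Nonempty := ⟨(t₁, Int.fract u₁), ⟨⟨ht₁.1, le_rfl⟩, hI u₁⟩, by
    simpa [hfract t₁ ht₁] using hu₁⟩
  obtain ⟨⟨t, u⟩, ⟨⟨⟨hat, htt⟩, hu⟩, hle⟩, hmin⟩ := hScl.exists_isMinOn hSne continuousOn_fst
  dsimp only at hat htt hu hle
  have htb : t < b := htt.trans_lt ht₁.2
  have hat' : a < t := by
    rcases hat.lt_or_eq with h | h
    · exact h
    · subst h; exact absurd (h0 u) (not_lt.2 hle)
  have hbefore : ∀ s ∈ Ico a t, ∀ v, K s v < c s := by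
    intro s hs v
    by_contra! hsv
    have hsb : s ∈ Ico a b := ⟨hs.1, hs.2.trans htb⟩
    have : (s, Int.fract v) ∈ S := ⟨⟨⟨hs.1, (hs.2.trans_le htt).le⟩, hI v⟩, by
      simpa [hfract s hsb] using hsv⟩
    have := isMinOn_iff.1 hmin _ this
    exact absurd hs.2 (not_lt.2 this)
  -- Strict inequality at earlier times passes to a weak one in the limit from the left, so the
  -- contact point is a spatial maximum.
  have hcl : ∀ v, K t v ≤ c t := by
    intro v
    have hm : Ico a b ∈ 𝓝[<] t := mem_of_superset (Ico_mem_nhdsLT hat')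
      (Ico_subset_Ico_right htb.le)
    have h1 : Tendsto (fun s => K s v) (𝓝[<] t) (𝓝 (K t v)) := by
      have := (hK.comp (f := fun s : ℝ => (s, v)) (s := Ico a b) (by fun_prop)
        (fun s hs => ⟨hs, mem_univ _⟩)) t ⟨hat, htb⟩
      exact this.mono_left (nhdsWithin_le_of_mem hm)
    have h2 : Tendsto c (𝓝[<] t) (𝓝 (c t)) := 
      Tendsto.mono_left (hc t ⟨hat, htb⟩) (nhdsWithin_le_of_mem hm)
    refine le_of_tendsto_of_tendsto h1 h2 ?_
    filter_upwards [Ico_mem_nhdsLT hat'] with s hs using (hbefore s hs v).le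
  have heq : K t u = c t := le_antisymm (hcl u) hle
  exact htouch t ⟨hat', htb⟩ u heq (fun v => heq ▸ hcl v) fun s hs => hbefore s hs u

/-! ### Geometry of a single curve -/

open ComplexConjugate in
theorem hasDerivAt_norm_of_ne_zero {w : ℝ → ℂ} {w' : ℂ} {u : ℝ} (hw : HasDerivAt w w' u)
    (h0 : w u ≠ 0) : HasDerivAt (fun x => ‖w x‖) ((conj (w u) * w').re / ‖w u‖) u := by
  have hv : ‖w u‖ ≠ 0 := norm_ne_zero_iff.2 h0
  have h := (hw.norm_sq).sqrt (by positivity)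
  simp only [Real.sqrt_sq (norm_nonneg _)] at h
  convert h using 1
  rw [Complex.inner]
  field_simp

theorem norm_sq_eq_re_im (w : ℂ) : ‖w‖ ^ 2 = w.re ^ 2 + w.im ^ 2 := by
  rw [Complex.sq_norm, Complex.normSq_apply]; ring

open ComplexConjugate in
/-- The derivative of the curvature of a family of curves with first and second derivatives
`w` and `z`, where the derivatives of the first two are as for a stationary speed. -/
theorem hasDerivAt_im_div_norm_pow_three {w z : ℝ → ℂ} {a b t : ℝ} (h0 : w t ≠ 0)
    (hw : HasDerivAt w (-a • w t) t)
    (hz : HasDerivAt z (b • (Complex.I * (‖w t‖⁻¹ • w t)) - a • z t) t) :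
    HasDerivAt (fun s => (conj (w s) * z s).im / ‖w s‖ ^ 3)
      (b / ‖w t‖ ^ 2 + a * ((conj (w t) * z t).im / ‖w t‖ ^ 3)) t := by
  have hv : ‖w t‖ ≠ 0 := norm_ne_zero_iff.2 h0
  have h1 : HasDerivAt (fun s => (conj (w s) * z s).im) _ t :=
    Complex.imCLM.hasFDerivAt.comp_hasDerivAt t
      ((Complex.conjCLE.hasFDerivAt.comp_hasDerivAt t hw).mul hz)
  refine (h1.div ((hasDerivAt_norm_of_ne_zero hw h0).pow 3) (pow_ne_zero 3 hv)).congr_deriv ?_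
  simp only [Function.comp_apply, Pi.pow_apply, Complex.imCLM_apply,
    ContinuousLinearEquiv.coe_coe, Complex.conjCLE_apply]
  generalize w t = w at *
  generalize z t = z at *
  have hw := norm_sq_eq_re_im w
  simp only [Complex.mul_re, Complex.mul_im, Complex.I_re, Complex.I_im, Complex.add_im,
    Complex.sub_re, Complex.sub_im, Complex.smul_re, Complex.smul_im,
    Complex.conj_re, Complex.conj_im, smul_eq_mul]
  push_cast
  field_simp
  linear_combination (-(‖w‖ * b + 3 * a * (w.re * z.im - w.im * z.re))) * hw

open ComplexConjugate in
-- The Frenet formula `∂ᵤν = -κ ∂ᵤγ`. The coefficient is kept explicit because `curvature_eq` is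
-- deduced from it through `τ = -iν`.
theorem hasDerivAt_normal {γ : ℝ → ℂ} {u : ℝ} (hγ : DifferentiableAt ℝ (deriv γ) u)
    (h0 : deriv γ u ≠ 0) :
    HasDerivAt (normal γ)
      (-((conj (deriv γ u) * deriv (deriv γ) u).im / ‖deriv γ u‖ ^ 3) • deriv γ u) u := by
  have hv : ‖deriv γ u‖ ≠ 0 := norm_ne_zero_iff.2 h0
  have hn : HasDerivAt (fun x => ‖deriv γ x‖)
      ((conj (deriv γ u) * deriv (deriv γ) u).re / ‖deriv γ u‖) u :=
    hasDerivAt_norm_of_ne_zero hγ.hasDerivAt h0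
  have h := ((hn.inv hv).smul hγ.hasDerivAt).const_mul Complex.I
  refine h.congr_deriv ?_
  simp only [Pi.inv_apply]
  generalize deriv γ u = w at hv
  generalize deriv (deriv γ) u = z
  have hw := norm_sq_eq_re_im w
  apply Complex.ext
  · simp only [Complex.mul_re, Complex.mul_im, Complex.I_re, Complex.I_im, Complex.add_re,
      Complex.add_im, Complex.smul_re, Complex.smul_im, Complex.conj_re, Complex.conj_im, smul_eq_mul]
    field_simp
    linear_combination (-z.im) * hw
  · simp only [Complex.mul_re, Complex.mul_im, Complex.I_re, Complex.I_im, Complex.add_re,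
      Complex.add_im, Complex.smul_re, Complex.smul_im, Complex.conj_re, Complex.conj_im, smul_eq_mul]
    field_simp
    linear_combination (z.re) * hw

open ComplexConjugate in
theorem curvature_eq {γ : ℝ → ℂ} {u : ℝ} (hγ : DifferentiableAt ℝ (deriv γ) u)
    (h0 : deriv γ u ≠ 0) :
    curvature γ u = (conj (deriv γ u) * deriv (deriv γ) u).im / ‖deriv γ u‖ ^ 3 := by
  have hv : ‖deriv γ u‖ ≠ 0 := norm_ne_zero_iff.2 h0
  have h := (hasDerivAt_normal hγ h0).const_mul (-Complex.I)
  have ht := h.congr_of_eventuallyEq (f₁ := tangent γ) <| Eventually.of_forall fun x => by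
    simp [normal, ← mul_assoc]
  rw [curvature, curvatureVec, arcDeriv, ht.deriv]
  simp only [normal, tangent, arcDeriv]
  generalize (conj (deriv γ u) * deriv (deriv γ) u).im / ‖deriv γ u‖ ^ 3 = k
  generalize deriv γ u = w at *
  have hw := norm_sq_eq_re_im w
  rw [Complex.inner]
  simp
  field_simp
  linear_combination -k * hw

/-- The integrand of the total curvature is the rate of change of the argument of `γ'`, the
imaginary part of its logarithmic derivative. -/
theorem curvature_mul_norm_deriv {γ : ℝ → ℂ} {u : ℝ} (hγ : DifferentiableAt ℝ (deriv γ) u)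
    (h0 : deriv γ u ≠ 0) :
    curvature γ u * ‖deriv γ u‖ = (deriv (deriv γ) u / deriv γ u).im := by
  have hv : ‖deriv γ u‖ ≠ 0 := norm_ne_zero_iff.2 h0
  rw [curvature_eq hγ h0, Complex.div_im, Complex.normSq_eq_norm_sq]
  simp
  field_simp
  ring

theorem periodic_deriv {γ : ℝ → ℂ} (h : Function.Periodic γ 1) :
    Function.Periodic (deriv γ) 1 := fun u => by
  rw [← deriv_comp_add_const, show (fun x => γ (x + 1)) = γ from funext h]

theorem periodic_curvature {γ : ℝ → ℂ} (h : Function.Periodic γ 1) (hγ : ContDiff ℝ 2 γ)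
    (h0 : ∀ u, deriv γ u ≠ 0) : Function.Periodic (curvature γ) 1 := fun u => by
  have hd : Differentiable ℝ (deriv γ) := (hγ.iterate_deriv' 1 1).differentiable (by simp)
  rw [curvature_eq (hd _) (h0 _), curvature_eq (hd _) (h0 _), periodic_deriv h,
    periodic_deriv (periodic_deriv h)]

theorem continuous_curvature {γ : ℝ → ℂ} (hγ : ContDiff ℝ 2 γ)
    (h0 : ∀ u, deriv γ u ≠ 0) : Continuous (curvature γ) := by
  have hd : Differentiable ℝ (deriv γ) := (hγ.iterate_deriv' 1 1).differentiable (by simp)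
  have h2 : Continuous (deriv (deriv γ)) := (hγ.iterate_deriv' 0 2).continuous
  rw [show curvature γ = _ from funext fun u => curvature_eq (hd u) (h0 u)]
  have := hd.continuous
  exact (Complex.continuous_im.comp ((Complex.continuous_conj.comp this).mul h2)).div
    (by fun_prop) fun u => pow_ne_zero _ (norm_ne_zero_iff.2 (h0 u))

theorem curvature_le_maxCurvature {γ : ℝ → ℂ} (h : Function.Periodic γ 1) (hγ : ContDiff ℝ 2 γ)
    (h0 : ∀ u, deriv γ u ≠ 0) (u : ℝ) : curvature γ u ≤ maxCurvature γ :=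
  le_csSup ((periodic_curvature h hγ h0).compact_of_continuous one_ne_zero
    (continuous_curvature hγ h0)).bddAbove ⟨u, rfl⟩

/-- The total curvature of a closed curve is a multiple of `2 * π`. -/
theorem exists_totalCurvature_eq {γ : ℝ → ℂ} (h : Function.Periodic γ 1) (hγ : ContDiff ℝ 2 γ)
    (h0 : ∀ u, deriv γ u ≠ 0) : ∃ m : ℤ, totalCurvature γ = m * (2 * Real.pi) := by
  have hd : Differentiable ℝ (deriv γ) := (hγ.iterate_deriv' 1 1).differentiable (by simp)
  have h2 : Continuous (deriv (deriv γ)) := (hγ.iterate_deriv' 0 2).continuous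
  have hq : Continuous fun u => deriv (deriv γ) u / deriv γ u := h2.div hd.continuous h0
  set I : ℝ → ℂ := fun x => ∫ u in (0 : ℝ)..x, deriv (deriv γ) u / deriv γ u with hI
  have hId : ∀ x, HasDerivAt I (deriv (deriv γ) x / deriv γ x) x := fun x =>
    intervalIntegral.integral_hasDerivAt_right (hq.intervalIntegrable _ _)
      (hq.stronglyMeasurableAtFilter _ _) hq.continuousAt
  -- `exp ∘ I` solves the same linear equation as `γ'`, so their quotient is constant; periodicity
  -- of `γ'` then gives `exp (I 1) = 1`.
  have hconst : ∀ x, HasDerivAt (fun x => deriv γ x * Complex.exp (-I x)) 0 x := fun x => by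
    refine ((hd x).hasDerivAt.mul (hId x).neg.cexp).congr_deriv ?_
    have := div_mul_cancel₀ (deriv (deriv γ) x) (h0 x)
    simp only [Pi.neg_apply]
    linear_combination (-Complex.exp (-I x)) * this
  have h01 := is_const_of_deriv_eq_zero (fun x => (hconst x).differentiableAt)
    (fun x => (hconst x).deriv) 0 1
  have hp : deriv γ 1 = deriv γ 0 := by simpa using periodic_deriv h 0
  have hexp : Complex.exp (-I 1) = 1 := by
    have hI0 : I 0 = 0 := by simp [hI]
    rw [hp, hI0] at h01
    simpa using (mul_left_cancel₀ (h0 0) h01).symm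
  obtain ⟨m, hm⟩ := Complex.exp_eq_one_iff.1 hexp
  refine ⟨-m, ?_⟩
  have him : totalCurvature γ = (I 1).im := by
    simp only [totalCurvature, arcIntegral, hI, curvature_mul_norm_deriv (hd _) (h0 _)]
    exact Complex.imCLM.intervalIntegral_comp_comm (hq.intervalIntegrable 0 1)
  rw [him, ← neg_neg (I 1), hm]
  simp

theorem length_pos {γ : ℝ → ℂ} (hγ : ContDiff ℝ 2 γ) (h0 : ∀ u, deriv γ u ≠ 0) :
    0 < length γ := by
  have hd : Continuous (deriv γ) := (hγ.iterate_deriv' 1 1).continuous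
  simp only [length, arcIntegral, one_mul]
  exact intervalIntegral.intervalIntegral_pos_of_pos (hd.norm.intervalIntegrable _ _)
    (fun u => norm_pos_iff.2 (h0 u)) one_pos

theorem arcIntegral_nonneg {γ : ℝ → ℂ} {h : ℝ → ℝ} (hh : ∀ u, 0 ≤ h u) :
    0 ≤ arcIntegral γ h :=
  intervalIntegral.integral_nonneg zero_le_one fun u _ => mul_nonneg (hh u) (norm_nonneg _)

/-! ### The flow -/

namespace IsClassicalSolution

variable {flow : Flow} {F : ℝ → ℝ → ℂ} {T : ℝ}

theorem differentiable_deriv (hF : IsClassicalSolution flow F T) {t : ℝ} (ht : t ∈ Ico 0 T) :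
    Differentiable ℝ (deriv (F t)) :=
  ((hF.contDiff t ht).iterate_deriv' 1 1).differentiable (by simp)

/-- A continuous function of time on an interval with values in `2πℤ` is constant. -/
theorem totalCurvature_eq (hF : IsClassicalSolution flow F T) {t : ℝ} (ht : t ∈ Ico 0 T) :
    totalCurvature (F t) = totalCurvature (F 0) := by
  have h0 : (0 : ℝ) ∈ Ico 0 T := ⟨le_rfl, ht.1.trans_lt ht.2⟩
  have hemb : Continuous fun p : Ico 0 T × ℝ => ((p.1 : ℝ), p.2) := by fun_prop
  have hmem : ∀ p : Ico 0 T × ℝ, ((p.1 : ℝ), p.2) ∈ Ico 0 T ×ˢ (univ : Set ℝ) :=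
    fun p => ⟨p.1.2, mem_univ _⟩
  have hc : Continuous fun s : Ico 0 T => totalCurvature (F s) := by
    have : ∀ s : Ico 0 T, totalCurvature (F s) =
        ∫ u in (0 : ℝ)..1, (deriv (deriv (F s)) u / deriv (F s) u).im := fun s => by
      simp only [totalCurvature, arcIntegral,
        curvature_mul_norm_deriv (hF.differentiable_deriv s.2 _) (hF.immersed s s.2 _)]
    simp only [this]
    refine intervalIntegral.continuous_parametric_intervalIntegral_of_continuous' ?_ 0 1
    exact Complex.continuous_im.comp ((hF.continuousOn_deriv_two.comp_continuous hemb hmem).div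
      (hF.continuousOn_deriv.comp_continuous hemb hmem) fun p => hF.immersed _ p.1.2 _)
  have : PreconnectedSpace (Ico 0 T) := isPreconnected_iff_preconnectedSpace.1 isPreconnected_Ico
  choose m hm using fun s : Ico 0 T =>
    exists_totalCurvature_eq (hF.periodic s s.2) (hF.contDiff s s.2) (hF.immersed s s.2)
  have hmc : Continuous m := by
    rw [Int.isClosedEmbedding_coe_real.isInducing.continuous_iff]
    refine (hc.div_const (2 * Real.pi)).congr fun s => ?_
    rw [hm s]
    simp [Real.pi_ne_zero]
  exact (hm ⟨t, ht⟩).trans ((PreconnectedSpace.constant ‹_› hmc (x := ⟨t, ht⟩) (y := ⟨0, h0⟩)) ▸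
    (hm ⟨0, h0⟩).symm)

/-- Admissibility forbids a zero of the area, so by the intermediate value theorem its sign cannot
change. -/
theorem signedArea_pos (hF : IsClassicalSolution .JP F T) (h0 : 0 < signedArea (F 0)) {t : ℝ}
    (ht : t ∈ Ico 0 T) : 0 < signedArea (F t) := by
  have hemb : Continuous fun p : Ico 0 T × ℝ => ((p.1 : ℝ), p.2) := by fun_prop
  have hmem : ∀ p : Ico 0 T × ℝ, ((p.1 : ℝ), p.2) ∈ Ico 0 T ×ˢ (univ : Set ℝ) :=
    fun p => ⟨p.1.2, mem_univ _⟩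
  have hc : Continuous fun s : Ico 0 T => signedArea (F s) := by
    have h1 : Continuous fun p : Ico 0 T × ℝ => deriv (F p.1) p.2 :=
      hF.continuousOn_deriv.comp_continuous hemb hmem
    have h2 : Continuous fun p : Ico 0 T × ℝ => F p.1 p.2 :=
      hF.continuousOn.comp_continuous hemb hmem
    have h3 : Continuous fun p : Ico 0 T × ℝ => normal (F p.1) p.2 :=
      continuous_const.mul ((h1.norm.inv₀ fun p =>
        norm_ne_zero_iff.2 (hF.immersed _ p.1.2 _)).smul h1)
    exact continuous_const.mul
      (intervalIntegral.continuous_parametric_intervalIntegral_of_continuous'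
        ((h2.inner h3).mul h1.norm) 0 1)
  by_contra! hle
  have : PreconnectedSpace (Ico 0 T) := isPreconnected_iff_preconnectedSpace.1 isPreconnected_Ico
  obtain ⟨s, hs⟩ := mem_range_of_exists_le_of_exists_ge hc ⟨⟨t, ht⟩, hle⟩
    ⟨⟨0, le_rfl, ht.1.trans_lt ht.2⟩, h0.le⟩
  exact hF.admissible s s.2 hs

/-- The speed of the flow falls short of the curvature. -/
theorem curvatureDeviation_sub_le (hF : IsClassicalSolution flow F T)
    (hn : 0 < totalCurvature (F 0)) (hA : flow = .JP → 0 < signedArea (F 0)) {t : ℝ}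
    (ht : t ∈ Ico 0 T) (u : ℝ) :
    curvatureDeviation (F t) u - flow.g (F t) / length (F t) ≤ curvature (F t) u := by
  have hL := length_pos (hF.contDiff t ht) (hF.immersed t ht)
  have hk : 0 < totalCurvature (F t) := hF.totalCurvature_eq ht ▸ hn
  -- This sum is `L` times the gap between curvature and speed. For (LP) `g ≥ 0`, and for (JP) the
  -- sum is `L² / (2A)`.
  have key : 0 ≤ totalCurvature (F t) + flow.g (F t) := by
    match flow with
    | .AP => simpa [Flow.g] using hk.le
    | .LP =>
      have := arcIntegral_nonneg (γ := F t) fun u => sq_nonneg (curvatureDeviation (F t) u)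
      simp only [Flow.g]
      positivity
    | .JP =>
      have := hF.signedArea_pos (hA rfl) ht
      simp only [Flow.g, add_sub_cancel]
      positivity
  have := div_nonneg key hL.le
  rw [add_div] at this
  rw [curvatureDeviation, one_div_mul_eq_div]
  linarith

theorem contDiff_slice (hF : IsClassicalSolution flow F T) {t : ℝ} (ht : t ∈ Ioo 0 T) :
    ContDiff ℝ ∞ (F t) := by
  rw [← contDiffOn_univ]
  exact hF.smooth.comp (f := fun u : ℝ => (t, u)) (by fun_prop) fun u _ => ⟨ht, mem_univ _⟩

theorem continuousOn_curvature (hF : IsClassicalSolution flow F T) :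
    ContinuousOn (fun p : ℝ × ℝ => curvature (F p.1) p.2) (Ico 0 T ×ˢ univ) := by
  have h : ∀ p ∈ Ico 0 T ×ˢ (univ : Set ℝ), _ := fun p hp =>
    curvature_eq (hF.differentiable_deriv hp.1 p.2) (hF.immersed p.1 hp.1 p.2)
  refine ContinuousOn.congr ?_ h
  exact (Complex.continuous_im.comp_continuousOn
    ((Complex.continuous_conj.comp_continuousOn hF.continuousOn_deriv).mul
      hF.continuousOn_deriv_two)).div (hF.continuousOn_deriv.norm.pow 3) fun p hp =>
    pow_ne_zero _ (norm_ne_zero_iff.2 (hF.immersed p.1 hp.1 p.2))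

theorem contDiff_curvature (hF : IsClassicalSolution flow F T) {t : ℝ} (ht : t ∈ Ioo 0 T) :
    ContDiff ℝ ∞ (curvature (F t)) := by
  have ht' := Ioo_subset_Ico_self ht
  rw [show curvature (F t) = _ from funext fun u =>
    curvature_eq (hF.differentiable_deriv ht' u) (hF.immersed t ht' u)]
  have h1 : ContDiff ℝ ∞ (deriv (F t)) :=
    (contDiff_infty_iff_deriv.1 (hF.contDiff_slice ht)).2
  have h2 : ContDiff ℝ ∞ (deriv (deriv (F t))) := (contDiff_infty_iff_deriv.1 h1).2
  exact (Complex.imCLM.contDiff.comp ((Complex.conjCLE.contDiff.comp h1).mul h2)).div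
    ((h1.norm ℝ (hF.immersed t ht')).pow 3) fun u =>
      pow_ne_zero _ (norm_ne_zero_iff.2 (hF.immersed t ht' u))

open ComplexConjugate in
/-- The evolution of the curvature where it is stationary in space. -/
theorem hasDerivAt_curvature (hF : IsClassicalSolution flow F T) {t : ℝ} (ht : t ∈ Ioo 0 T)
    {u : ℝ} (hu : deriv (curvature (F t)) u = 0) :
    HasDerivAt (fun s => curvature (F s) u)
      (deriv (deriv (curvature (F t))) u / ‖deriv (F t) u‖ ^ 2 +
        (curvatureDeviation (F t) u - flow.g (F t) / length (F t)) * curvature (F t) u ^ 2) t := by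
  have ht' := Ioo_subset_Ico_self ht
  have hU : IsOpen (Ioo 0 T ×ˢ (univ : Set ℝ)) := isOpen_Ioo.prod isOpen_univ
  set V : ℝ → ℝ := fun x => curvatureDeviation (F t) x - flow.g (F t) / length (F t) with hV
  have hcurv := hF.contDiff_curvature ht
  have hcd : Differentiable ℝ (curvature (F t)) := hcurv.differentiable (by simp)
  have hcd' : Differentiable ℝ (deriv (curvature (F t))) :=
    (contDiff_infty_iff_deriv.1 hcurv).2.differentiable (by simp)
  have hVd : ∀ x, HasDerivAt V (deriv (curvature (F t)) x) x := fun x => 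
    ((hcd x).hasDerivAt.sub_const (1 / length (F t) * totalCurvature (F t))).sub_const
      (flow.g (F t) / length (F t))
  have hN : ∀ x, HasDerivAt (normal (F t)) (-curvature (F t) x • deriv (F t) x) x := fun x => by
    rw [curvature_eq (hF.differentiable_deriv ht' x) (hF.immersed t ht' x)]
    exact hasDerivAt_normal (hF.differentiable_deriv ht' x) (hF.immersed t ht' x)
  have e0 : (fun x => deriv (fun s => F s x) t) = fun x => V x • normal (F t) x :=
    funext fun x => (hF.equation t ht x).deriv
  have e1 : (fun x => deriv (fun s => deriv (F s) x) t) = fun x =>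
      V x • (-curvature (F t) x • deriv (F t) x) + deriv (curvature (F t)) x • normal (F t) x :=
    funext fun x => by
      rw [(hasDerivAt_deriv_slice hU hF.smooth (t := t) (u := x) ⟨ht, mem_univ _⟩).deriv, e0]
      exact ((hVd x).smul (hN x)).deriv
  have d1 : HasDerivAt (fun s => deriv (F s) u) _ t :=
    hasDerivAt_deriv_slice hU hF.smooth (t := t) (u := u) ⟨ht, mem_univ _⟩
  have d2 : HasDerivAt (fun s => deriv (deriv (F s)) u) _ t :=
    hasDerivAt_deriv_slice hU (contDiffOn_deriv_slice hU hF.smooth) (t := t) (u := u)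
      ⟨ht, mem_univ _⟩
  have e2 : HasDerivAt (fun x => V x • (-curvature (F t) x • deriv (F t) x) +
      deriv (curvature (F t)) x • normal (F t) x) _ u :=
    ((hVd u).smul ((hcd u).hasDerivAt.neg.smul
      (hF.differentiable_deriv ht' u).hasDerivAt)).add ((hcd' u).hasDerivAt.smul (hN u))
  have e3 : HasDerivAt (fun x => V x • normal (F t) x) _ u := (hVd u).smul (hN u)
  simp only at d1 d2
  rw [e1, e2.deriv] at d2
  rw [e0, e3.deriv] at d1
  have hk := curvature_eq (hF.differentiable_deriv ht' u) (hF.immersed t ht' u)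
  -- Since `V` and `κ` differ by a constant in space, `∂ᵤκ = 0` also kills `∂ᵤV`; what remains is
  -- `∂ₜFᵤ = -Vκ Fᵤ` and `∂ₜFᵤᵤ = κᵤᵤ ν - Vκ Fᵤᵤ`.
  refine (hasDerivAt_im_div_norm_pow_three (w := fun s => deriv (F s) u)
    (z := fun s => deriv (deriv (F s)) u) (a := V u * curvature (F t) u)
    (b := deriv (deriv (curvature (F t))) u) (hF.immersed t ht' u)
    (d1.congr_deriv ?_) (d2.congr_deriv ?_)).congr_of_eventuallyEq ?_ |>.congr_deriv ?_
  · simp only [hu, zero_smul, add_zero, smul_smul, mul_neg]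
  · simp only [hu, zero_smul, add_zero, mul_smul, neg_zero, zero_add, Pi.neg_apply,
      normal, tangent, arcDeriv, neg_smul, smul_neg]
    abel
  · filter_upwards [isOpen_Ioo.mem_nhds ht] with s hs
    have hs' := Ioo_subset_Ico_self hs
    exact curvature_eq (hF.differentiable_deriv hs' u) (hF.immersed s hs' u)
  · rw [← hk]
    ring

end IsClassicalSolution

/-! ### Comparison with an ordinary differential equation -/

/-- The solution `(α - β (s - a)) ^ (-1 / 2)` of `c' = (β / 2) c ^ 3`. -/
theorem hasDerivAt_inv_sqrt_linear {α β a s : ℝ} (h : 0 < α - β * (s - a)) :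
    HasDerivAt (fun s => (√(α - β * (s - a)))⁻¹) (β / 2 * (√(α - β * (s - a)))⁻¹ ^ 3) s := by
  have h1 : HasDerivAt (fun s => α - β * (s - a)) (-β) s := by
    simpa using (((hasDerivAt_id s).sub_const a).const_mul β).const_sub α
  have hs : √(α - β * (s - a)) ≠ 0 := (Real.sqrt_pos.2 h).ne'
  refine ((h1.sqrt h.ne').inv hs).congr_deriv ?_
  field_simp

/-- Comparison of the curvature with a solution of `c' = (β / 2) c ^ 3`, `β > 2`. -/
theorem IsClassicalSolution.curvature_lt {flow : Flow} {F : ℝ → ℝ → ℂ} {T : ℝ}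
    (hF : IsClassicalSolution flow F T) (hn : 0 < totalCurvature (F 0))
    (hA : flow = .JP → 0 < signedArea (F 0)) {t α β : ℝ} (ht : 0 ≤ t) (hβ : 2 < β)
    (hαβ : 0 < α - β * (T - t)) (h0 : ∀ u, curvature (F t) u < (√α)⁻¹) :
    ∀ s ∈ Ico t T, ∀ u, curvature (F s) u < (√(α - β * (s - t)))⁻¹ := by
  have hsub : Ico t T ⊆ Ico 0 T := Ico_subset_Ico_left ht
  have hpos : ∀ s ∈ Ico t T, 0 < α - β * (s - t) := fun s hs => by nlinarith [hs.2]
  refine lt_of_no_touching (K := fun s => curvature (F s))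
    (hF.continuousOn_curvature.mono (prod_mono hsub le_rfl))
    (fun s hs => periodic_curvature (hF.periodic s (hsub hs)) (hF.contDiff s (hsub hs))
      (hF.immersed s (hsub hs)))
    (fun s hs => (hasDerivAt_inv_sqrt_linear (hpos s hs)).continuousAt.continuousWithinAt)
    (by simpa using h0) ?_
  intro s hs u heq hmax hbefore
  have hs0 : s ∈ Ioo 0 T := ⟨ht.trans_lt hs.1, hs.2⟩
  have hloc : IsLocalMax (curvature (F s)) u := Eventually.of_forall hmax
  have hd := (hF.hasDerivAt_curvature hs0 hloc.deriv_eq_zero).sub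
    (hasDerivAt_inv_sqrt_linear (hpos s (Ioo_subset_Ico_self hs)))
  have hnn := deriv_nonneg_of_le_left hd hs.1 fun r hr => by
    have := hbefore r hr
    simp only [Pi.sub_apply]
    linarith
  have huu := div_nonpos_of_nonpos_of_nonneg (deriv_deriv_nonpos_of_isLocalMax hloc
    (hF.contDiff_curvature hs0).continuous.continuousAt) (sq_nonneg ‖deriv (F s) u‖)
  have hV := mul_le_mul_of_nonneg_right (hF.curvatureDeviation_sub_le hn hA
    (Ioo_subset_Ico_self hs0) u) (sq_nonneg (curvature (F s) u))
  have hc : 0 < (√(α - β * (s - t)))⁻¹ :=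
    inv_pos.2 (Real.sqrt_pos.2 (hpos s (Ioo_subset_Ico_self hs)))
  rw [heq] at hnn hV
  -- At the contact `κ = c`, so the derivative of `κ - c` is at most `(1 - β / 2) c³ < 0`, against
  -- `hnn`.
  nlinarith [pow_pos hc 3]

end CurveFlow
end

theorem mainTheorem5 (flow : CurveFlow.Flow) (F : ℝ → ℝ → ℂ) (T : ℝ) (hT : 0 < T)
    (hF : CurveFlow.IsBlowUpTime flow F T)
    (hn : 1 ≤ CurveFlow.rotationNumber (F 0))
    (hA : flow = CurveFlow.Flow.JP → 0 < CurveFlow.signedArea (F 0))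
    (hK : limsup (fun t => (CurveFlow.maxCurvature (F t) : EReal)) (𝓝[<] T) = ⊤) :
    ∀ t ∈ Ico 0 T, 1 / √(2 * (T - t)) ≤ CurveFlow.maxCurvature (F t) := by
  intro t ht
  by_contra! hlt
  have hs := hF.1
  have hD : 0 < T - t := sub_pos.2 ht.2
  have hn' : 0 < CurveFlow.totalCurvature (F 0) := by
    by_contra! hle
    have : CurveFlow.rotationNumber (F 0) ≤ 0 :=
      mul_nonpos_of_nonneg_of_nonpos (by positivity) hle
    linarith
  -- The maximum with `0` ensures `m > 0`, whatever the sign of the maximal curvature.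
  obtain ⟨m, hm, hmD⟩ := exists_between (max_lt hlt (by positivity : 0 < 1 / √(2 * (T - t))))
  have hm0 : 0 < m := (le_max_right _ _).trans_lt hm
  have hα : 2 * (T - t) < (m ^ 2)⁻¹ := by
    have hsq : 0 < √(2 * (T - t)) := by positivity
    rw [lt_div_iff₀ hsq] at hmD
    have := pow_lt_one₀ (by positivity) hmD two_ne_zero
    rw [mul_pow, Real.sq_sqrt (by positivity)] at this
    rw [lt_inv_comm₀ (by positivity) (by positivity), lt_inv_comm₀ (by positivity) (by positivity),
      ← one_div, lt_div_iff₀ (by positivity)]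
    linarith
  -- The barrier starts at `m` and blows up only after `T`, because `β (T - t) < m⁻²`, while `β > 2`
  -- makes the comparison strict.
  obtain ⟨β, hβ, hβα⟩ := exists_between ((lt_div_iff₀ hD).2 hα)
  rw [lt_div_iff₀ hD] at hβα
  have hpos : 0 < (m ^ 2)⁻¹ - β * (T - t) := sub_pos.2 hβα
  have hcurv := hs.curvature_lt hn' hA ht.1 hβ hpos fun u => by
    rw [Real.sqrt_inv, Real.sqrt_sq hm0.le, inv_inv]
    exact (CurveFlow.curvature_le_maxCurvature (hs.periodic t ht) (hs.contDiff t ht)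
      (hs.immersed t ht) u).trans_lt ((le_max_left _ _).trans_lt hm)
  have hbound : ∀ s ∈ Ico t T,
      CurveFlow.maxCurvature (F s) ≤ (√((m ^ 2)⁻¹ - β * (T - t)))⁻¹ := fun s hs' => by
    refine csSup_le (range_nonempty _) ?_
    rintro _ ⟨u, rfl⟩
    refine (hcurv s hs' u).le.trans (inv_anti₀ (Real.sqrt_pos.2 hpos) (Real.sqrt_le_sqrt ?_))
    -- The barrier increases, so its value at `T` bounds the curvature on all of `[t, T)`.
    nlinarith [hs'.2]
  have hle : limsup (fun t => (CurveFlow.maxCurvature (F t) : EReal)) (𝓝[<] T) ≤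
      (((√((m ^ 2)⁻¹ - β * (T - t)))⁻¹ : ℝ) : EReal) := by
    refine limsup_le_of_le (by isBoundedDefault) ?_
    filter_upwards [Ico_mem_nhdsLT ht.2] with s hs' using EReal.coe_le_coe_iff.2 (hbound s hs')
  rw [hK] at hle
  exact absurd hle (not_le.2 (EReal.coe_lt_top _))
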